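/- Let $\mathcal G=\langle\mathcal V,\mathcal E\rangle$ be a finite graph (loops allowed; edges may be directed) in which every vertex $v$ has a non-empty set $\mathrm{adj}(v)$ of adjacent vertices; let $N$ be the number of pursuing units and $\gamma\in[0,1)$ the discount factor. For $s=(s_1,\dots,s_N)\in\mathcal V^N$ put $\mathrm{adj}(s)=\mathrm{adj}(s_1)\times\dots\times\mathrm{adj}(s_N)$, and write $e\in s$ if $e=s_i$ for some $i$. For $t\ge 0$, $s_p^0\in\mathcal V^N$ and $b\in\Delta(\mathcal V)$, the horizon-$t$ game $G^t\langle s_p^0,b\rangle$ is the following zero-sum extensive-form game between the pursuer and the evader. Chance selects $s_e^0\in\mathcal V$ according to $b$. In each round $\tau+1$ both players move simultaneously, to $s_p^{\tau+1}\in\mathrm{adj}(s_p^\tau)$ and $s_e^{\tau+1}\in\mathrm{adj}(s_e^\tau)$. The game ends as soon as $s_e^\tau\in s_p^\tau$ (the evader is caught), and the pursuer then gets $\gamma^\tau$; if she is not caught within $t$ rounds, the game ends after round $t$ and the pursuer gets $0$. The pursuer observes only his own moves (and knows $s_p^0$ and $b$); the evader, when choosing $s_e^{\tau+1}$, knows the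 whole history $s_e^0s_p^1s_e^1\cdots s_p^\tau s_e^\tau$ but not $s_p^{\tau+1}$. Both players use behavioral strategies. The value $v^t\langle s_p^0\rangle(b)$ of the game is the pursuer's expected utility in a Nash equilibrium. A one-step strategy of the pursuer at $s_p^0$ is a distribution $\pi_p\in\Delta(\mathrm{adj}(s_p^0))$; a one-step strategy of the evader assigns to each $s_e\in\mathcal V$ a distribution $\pi_e(s_e,\cdot)\in\Delta(\mathrm{adj}(s_e))$. Theorem. For all $t\ge0$, $s_p^0$ and $b$, the game $G^t\langle s_p^0,b\rangle$ has a Nash equilibrium, all its equilibria give the pursuer the same expected utility, so that $v^t\langle s_p^0\rangle(b)$ is well defined, and $v^t\langle s_p^0\rangle(b)\in[0,1]$. For all $t\ge 1$, $s_p^0$ and $b$, $$v^t\langle s_p^0\rangle(b)=\sum_{s_e\in s_p^0}b(s_e)+\gamma\Big[\sum_{s_e\in\mathcal V\setminus s_p^0}b(s_e)\Big]\cdot\max_{\pi_p}\min_{\pi_e}\sum_{s_p^1\in\mathcal V^N}\pi_p(s_p^1)\cdot v^{t-1}\langle s_p^1\rangle(b_{\pi_e}),$$ where the maximum and the minima are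 attained, and the transformed belief $b_{\pi_e}\in\Delta(\mathcal V)$ is $$b_{\pi_e}(s_e')=\frac{1}{\sum_{s_e\in\mathcal V\setminus s_p^0}b(s_e)}\sum_{s_e\in\mathcal V\setminus s_p^0}b(s_e)\cdot\pi_e(s_e,s_e').$$ (If $\sum_{s_e\in\mathcal V\setminus s_p^0}b(s_e)=0$, the second term of the formula for $v^t$ is $0$ and $b_{\pi_e}$ may be any fixed belief, say $b$.) Consequently the operator $H$ that maps a family $v=(v\langle s\rangle)_{s\in\mathcal V^N}$ of functions $\Delta(\mathcal V)\to[0,1]$ to the family of functions given by the right-hand side with $v$ in place of $v^{t-1}$ (with $\sup$ and $\inf$ for $\max$ and $\min$) again gives functions $\Delta(\mathcal V)\to[0,1]$, and $v^t=Hv^{t-1}$ for all $t\ge1$. -/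

import Mathlib

noncomputable section

namespace PursuitEvasion

/-- `Δ(A)`: the probability distributions on a finite type that are supported on the set `A`. -/
def DistOn {α : Type*} [Fintype α] (A : Set α) : Type _ :=
  {π : α → ℝ // π ∈ stdSimplex ℝ α ∧ ∀ a, a ∉ A → π a = 0}

/-- The probability `π(a)`. -/
def DistOn.prob {α : Type*} [Fintype α] {A : Set α} (π : DistOn A) (a : α) : ℝ := π.1 a

/-- Beliefs `Δ(V)` about the position of the evader. -/
abbrev Belief (V : Type*) [Fintype V] : Type _ := stdSimplex ℝ V

/-- Joint positions `V^N` of the `N` units of the pursuer. -/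
abbrev Pos (V : Type*) (N : ℕ) : Type _ := Fin N → V

/-- `adj(v)`: the vertices adjacent to `v`. -/
def adj {V : Type*} (G : Digraph V) (v : V) : Set V := {w | G.Adj v w}

/-- `adj(s) = adj(s_1) × ... × adj(s_N)`. -/
def adjPos {V : Type*} (G : Digraph V) {N : ℕ} (s : Pos V N) : Set (Pos V N) :=
  {p | ∀ i, p i ∈ adj G (s i)}

/-- The evader at `e` is caught by units at `p`: some unit stands at `e`. -/
def Caught {V : Type*} {N : ℕ} (p : Pos V N) (e : V) : Prop := ∃ i, p i = e

/-! ### The game tree -/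

/-- Lists `s_e^0 s_p^1 s_e^1 ... s_p^τ s_e^τ`: the initial vertex of the evader, and for every
one of the rounds `1, ..., τ` the new positions of the pursuer and of the evader. -/
abbrev History (V : Type*) (N τ : ℕ) : Type _ := V × (Fin τ → Pos V N × V)

/-- The pursuer's positions `s_p^0, s_p^1, ..., s_p^k`, from `s_p^0` and his sequence of moves. -/
def pursuerPath {V : Type*} {N k : ℕ} (s : Pos V N) (m : Fin k → Pos V N) :
    Fin (k + 1) → Pos V N :=
  Fin.cons s m

/-- `h|_p`: the pursuer's sequence of moves in `h`. -/
def pursuerMoves {V : Type*} {N τ : ℕ} (h : History V N τ) : Fin τ → Pos V N :=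
  fun i => (h.2 i).1

/-- The evader's positions `s_e^0, s_e^1, ..., s_e^τ` in `h`. -/
def evaderPath {V : Type*} {N τ : ℕ} (h : History V N τ) : Fin (τ + 1) → V :=
  Fin.cons h.1 fun i => (h.2 i).2

/-- The part of `h` up to the end of round `k`. -/
def History.upTo {V : Type*} {N τ : ℕ} (h : History V N τ) (k : ℕ) (hk : k ≤ τ) :
    History V N k :=
  (h.1, fun i => h.2 (Fin.castLE hk i))

/-- The list `h` is a history of the games in which the pursuer starts at `s`: all moves follow
the graph, and the evader was not caught before the end of `h`. -/
def IsHistory {V : Type*} (G : Digraph V) {N τ : ℕ} (s : Pos V N) (h : History V N τ) : Prop :=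
  ∀ i : Fin τ,
    pursuerPath s (pursuerMoves h) i.succ ∈
        adjPos G (pursuerPath s (pursuerMoves h) i.castSucc) ∧
      evaderPath h i.succ ∈ adj G (evaderPath h i.castSucc) ∧
      ¬ Caught (pursuerPath s (pursuerMoves h) i.castSucc) (evaderPath h i.castSucc)

/-- The evader is caught in the last round of `h`. -/
def CaughtAtEnd {V : Type*} {N τ : ℕ} (s : Pos V N) (h : History V N τ) : Prop :=
  Caught (pursuerPath s (pursuerMoves h) (Fin.last τ)) (evaderPath h (Fin.last τ))

/-- Terminal histories of the horizon-`t` game: the evader has been caught, or `t` rounds have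
been played. -/
def IsTerminal {V : Type*} (G : Digraph V) (t : ℕ) {N τ : ℕ} (s : Pos V N)
    (h : History V N τ) : Prop :=
  IsHistory G s h ∧ (CaughtAtEnd s h ∨ τ = t)

open Classical in
/-- The pursuer's utility of a terminal history with `τ` rounds: `γ ^ τ` if the evader is caught,
`0` otherwise. -/
def utility {V : Type*} (γ : ℝ) {N τ : ℕ} (s : Pos V N) (h : History V N τ) : ℝ :=
  if CaughtAtEnd s h then γ ^ τ else 0

/-! ### Behavioral strategies -/

/-- Behavioral strategies of the pursuer in the horizon-`t` game. His information sets are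
identified with his sequences of moves `m = s_p^1 ... s_p^k`, `k < t`, and at each of them he
chooses a distribution on `adj(s_p^k)`. (Choices at sequences that violate the graph are never
used.) -/
abbrev PursuerStrategy {V : Type*} [Fintype V] (G : Digraph V) {N : ℕ} (t : ℕ)
    (s : Pos V N) : Type _ :=
  ∀ (k : Fin t) (m : Fin k → Pos V N), DistOn (adjPos G (pursuerPath s m (Fin.last k)))

/-- Behavioral strategies of the evader in the horizon-`t` game. She has one information set for
each history `h = s_e^0 s_p^1 s_e^1 ... s_p^k s_e^k`, `k < t`, after which the pursuer is to play;
it does not reveal the pursuer's move `s_p^(k+1)`. There she chooses a distribution on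
`adj(s_e^k)`. (Choices at lists `h` that are terminal or not histories are never used.) -/
abbrev EvaderStrategy {V : Type*} [Fintype V] (G : Digraph V) (N t : ℕ) : Type _ :=
  ∀ (k : Fin t) (h : History V N k), DistOn (adj G (evaderPath h (Fin.last k)))

/-- The probability that the history `h` is reached: the product of the probability of the chance
move `s_e^0` and of the probabilities of all moves of the two players. -/
def reachProb {V : Type*} [Fintype V] {G : Digraph V} {N t : ℕ} {s : Pos V N} (b : Belief V)
    (σp : PursuerStrategy G t s) (σe : EvaderStrategy G N t) {τ : ℕ} (hτ : τ ≤ t)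
    (h : History V N τ) : ℝ :=
  b.1 h.1 * ∏ k : Fin τ,
    (σp (Fin.castLE hτ k) (pursuerMoves (h.upTo k k.2.le))).prob (h.2 k).1 *
      (σe (Fin.castLE hτ k) (h.upTo k k.2.le)).prob (h.2 k).2

open Classical in
/-- The pursuer's expected utility in the horizon-`t` game with initial pursuer's position `s` and
initial belief `b`: the sum over all terminal histories of probability times utility. -/
def expectedUtility {V : Type*} [Fintype V] {G : Digraph V} (γ : ℝ) {N t : ℕ} {s : Pos V N}
    (b : Belief V) (σp : PursuerStrategy G t s) (σe : EvaderStrategy G N t) : ℝ :=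
  ∑ τ : Fin (t + 1), ∑ h : History V N τ with IsTerminal G t s h,
    reachProb b σp σe (Nat.le_of_lt_succ τ.2) h * utility γ s h

/-- Nash equilibria (the game is zero-sum; the evader's utility is minus the pursuer's). -/
def IsNash {V : Type*} [Fintype V] {G : Digraph V} (γ : ℝ) {N t : ℕ} {s : Pos V N}
    (b : Belief V) (σp : PursuerStrategy G t s) (σe : EvaderStrategy G N t) : Prop :=
  (∀ σp' : PursuerStrategy G t s, expectedUtility γ b σp' σe ≤ expectedUtility γ b σp σe) ∧
    ∀ σe' : EvaderStrategy G N t, expectedUtility γ b σp σe ≤ expectedUtility γ b σp σe'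

/-- `x` is the pursuer's expected utility in some Nash equilibrium of the horizon-`t` game. -/
def IsGameValue {V : Type*} [Fintype V] (G : Digraph V) (γ : ℝ) {N : ℕ} (t : ℕ) (s : Pos V N)
    (b : Belief V) (x : ℝ) : Prop :=
  ∃ (σp : PursuerStrategy G t s) (σe : EvaderStrategy G N t),
    IsNash γ b σp σe ∧ expectedUtility γ b σp σe = x

/-- The value functions `v^t⟨s⟩(b)`: the value of the horizon-`t` game with parameters `s`, `b`.
(An arbitrary number if there is no equilibrium.) -/
def valueFunction {V : Type*} [Fintype V] (G : Digraph V) (γ : ℝ) {N : ℕ} (t : ℕ) (s : Pos V N)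
    (b : Belief V) : ℝ :=
  Classical.epsilon fun x => IsGameValue G γ t s b x

/-! ### One-step strategies and the dynamic programming operator -/

/-- One-step strategies `π_p ∈ Δ(adj(s))` of the pursuer. -/
abbrev PursuerOneStep {V : Type*} [Fintype V] (G : Digraph V) {N : ℕ} (s : Pos V N) : Type _ :=
  DistOn (adjPos G s)

/-- One-step strategies of the evader: for each vertex `e` a distribution `π_e(e, ·)` on
`adj(e)`. -/
abbrev EvaderOneStep {V : Type*} [Fintype V] (G : Digraph V) : Type _ :=
  ∀ e : V, DistOn (adj G e)

open Classical in
/-- The probability `∑_{e ∈ s} b(e)` that the evader is caught at the start. -/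
def caughtMass {V : Type*} [Fintype V] {N : ℕ} (s : Pos V N) (b : Belief V) : ℝ :=
  ∑ e with Caught s e, b.1 e

open Classical in
/-- The probability `∑_{e ∉ s} b(e)` that the evader is not caught at the start. -/
def freeMass {V : Type*} [Fintype V] {N : ℕ} (s : Pos V N) (b : Belief V) : ℝ :=
  ∑ e with ¬ Caught s e, b.1 e

open Classical in
/-- The formula for the transformed belief `b_{π_e}`, meaningful if `freeMass s b ≠ 0`. -/
def transformedWeight {V : Type*} [Fintype V] {G : Digraph V} {N : ℕ} (s : Pos V N)
    (b : Belief V) (πe : EvaderOneStep G) (e' : V) : ℝ :=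
  1 / freeMass s b * ∑ e with ¬ Caught s e, b.1 e * (πe e).prob e'

theorem transformedWeight_mem {V : Type*} [Fintype V] {G : Digraph V} {N : ℕ} (s : Pos V N)
    (b : Belief V) (πe : EvaderOneStep G) (hb : freeMass s b ≠ 0) :
    transformedWeight s b πe ∈ stdSimplex ℝ V := by
  classical
  have hb0 : ∀ e, 0 ≤ b.1 e := b.2.1
  have hf : 0 ≤ freeMass s b := Finset.sum_nonneg fun e _ => hb0 e
  refine ⟨fun e' => mul_nonneg (by positivity) (Finset.sum_nonneg fun e _ =>
    mul_nonneg (hb0 e) ((πe e).2.1.1 e')), ?_⟩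
  have h1 : ∀ e, ∑ e', (πe e).prob e' = 1 := fun e => (πe e).2.1.2
  simp only [transformedWeight]
  rw [← Finset.mul_sum, Finset.sum_comm]
  simp only [← Finset.mul_sum, h1, mul_one]
  rw [one_div]
  exact inv_mul_cancel₀ hb

open Classical in
/-- The transformed belief `b_{π_e}`. If the evader is surely caught at the start, then there is
no such belief, and the (then irrelevant) value `b` is used. -/
def transformedBelief {V : Type*} [Fintype V] {G : Digraph V} {N : ℕ} (s : Pos V N)
    (b : Belief V) (πe : EvaderOneStep G) : Belief V :=
  if hb : freeMass s b = 0 then b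
  else ⟨transformedWeight s b πe, transformedWeight_mem s b πe hb⟩

/-- `∑_{s_p^1 ∈ V^N} π_p(s_p^1) v⟨s_p^1⟩(b_{π_e})`. -/
def continuation {V : Type*} [Fintype V] {G : Digraph V} {N : ℕ} (v : Pos V N → Belief V → ℝ)
    (s : Pos V N) (b : Belief V) (πp : PursuerOneStep G s) (πe : EvaderOneStep G) : ℝ :=
  ∑ p : Pos V N, πp.prob p * v p (transformedBelief s b πe)

/-- `x = max_a min_c f a c`, where the minima and the maximum are attained. -/
def IsMaxMin {A C : Type*} (f : A → C → ℝ) (x : ℝ) : Prop :=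
  ∃ m : A → ℝ, (∀ a, IsLeast (Set.range (f a)) (m a)) ∧ IsGreatest (Set.range m) x

/-- The dynamic programming operator `H`, defined for all bounded families of functions `v`. -/
def bellman {V : Type*} [Fintype V] (G : Digraph V) (γ : ℝ) {N : ℕ}
    (v : Pos V N → Belief V → ℝ) : Pos V N → Belief V → ℝ :=
  fun s b => caughtMass s b + γ * freeMass s b *
    ⨆ πp : PursuerOneStep G s, ⨅ πe : EvaderOneStep G, continuation v s b πp πe

end PursuitEvasion

end

noncomputable section

namespace PursuitEvasion

variable {V : Type*} [Fintype V] {G : Digraph V} {γ : ℝ} {N t : ℕ} {s : Pos V N}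

/-! The expected utility is linear in `b`, so a strategy of the pursuer matters through the vectors,
indexed by the evader's start vertex, that it secures against every reply. The best secured value is
the support function `maxmin` of these vectors at `b`. They obey a recursion: the pursuer never sees
the evader, so he fixes a distribution of his first move and, after each move, one vector of
continuation utilities; from a free vertex the evader may go to the neighbour that is worst for him.
Storing a vector together with the probability mass in front of it turns the secured vectors into
the convex cone `guarantees`, whose part of mass at most 1 is compact; moves of mass zero then need
no division.

In the first round the payoff is bilinear in the evader's one-step strategy `π` and the pursuer's
plan `q`, both from compact convex sets, so Sion's theorem yields a saddle point (`exists_saddle`).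
The plan `q` with worst replies gives a secured vector (`le_maxmin_succ`). Playing `π` and then
optimally for the transformed belief holds the pursuer to the same number
(`exists_optimal_evaderStrategy`). Hence `maxmin` is the value (`isGameValue_iff`).

The update formula needs one more argument, since its right-hand side lets the pursuer adapt the
continuation to `π_e`, which he does not know in the game. He gains nothing: against the saddle `π`,
no first move with its best continuation beats the saddle value (`maxmin_spread_le`), while the
masses of `q` secure at least that value (`planPayoff_le_sum_maxmin`). -/

theorem DistOn.prob_nonneg {α : Type*} [Fintype α] {A : Set α} (π : DistOn A) (a : α) :
    0 ≤ π.prob a :=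
  π.2.1.1 a

theorem DistOn.sum_prob {α : Type*} [Fintype α] {A : Set α} (π : DistOn A) :
    ∑ a, π.prob a = 1 :=
  π.2.1.2

theorem DistOn.prob_eq_zero {α : Type*} [Fintype α] {A : Set α} (π : DistOn A) {a : α}
    (ha : a ∉ A) : π.prob a = 0 :=
  π.2.2 a ha

/-- The same distribution on an equal set. -/
def DistOn.copy {α : Type*} [Fintype α] {A B : Set α} (π : DistOn A) (h : A = B) : DistOn B :=
  ⟨π.1, π.2.1, fun a ha => π.2.2 a (h ▸ ha)⟩

/-! ### Splitting off the first round -/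

omit [Fintype V] in
theorem evader_cons {τ : ℕ} (x : Pos V N × V) (m : Fin τ → Pos V N × V) :
    (fun i => ((Fin.cons x m : Fin (τ + 1) → Pos V N × V) i).2) =
      (Fin.cons x.2 (fun i => (m i).2) : Fin (τ + 1) → V) := by
  funext i
  refine Fin.cases rfl (fun j => rfl) i

omit [Fintype V] in
theorem pursuerMoves_cons {τ : ℕ} (e e' : V) (x : Pos V N × V) (m : Fin τ → Pos V N × V) :
    pursuerMoves ((e, Fin.cons x m) : History V N (τ + 1)) =
      (Fin.cons x.1 (pursuerMoves (N := N) (e', m)) : Fin (τ + 1) → Pos V N) := by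
  funext i
  refine Fin.cases rfl (fun j => rfl) i

/-- The first move of a strategy of the pursuer. -/
def PursuerStrategy.head (σ : PursuerStrategy G (t + 1) s) : PursuerOneStep G s :=
  σ 0 Fin.elim0

/-- The continuation of a strategy of the pursuer after the first move `p`. -/
def PursuerStrategy.tail (σ : PursuerStrategy G (t + 1) s) (p : Pos V N) :
    PursuerStrategy G t p :=
  fun k m => ⟨(σ k.succ (Fin.cons p m : Fin (k + 1) → Pos V N)).1,
    (σ k.succ (Fin.cons p m : Fin (k + 1) → Pos V N)).2⟩

/-- The first move of a strategy of the evader. -/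
def EvaderStrategy.head (σ : EvaderStrategy G N (t + 1)) : EvaderOneStep G :=
  fun e => σ 0 (e, Fin.elim0)

/-- The continuation of a strategy of the evader after she started at `e` and the pursuer moved
to `p` in the first round. -/
def EvaderStrategy.tail (σ : EvaderStrategy G N (t + 1)) (e : V) (p : Pos V N) :
    EvaderStrategy G N t :=
  -- The last vertex of the prolonged history agrees with that of `h` only propositionally; `copy`
  -- changes the index set and leaves the probabilities untouched.
  fun k h => (σ k.succ (e, (Fin.cons (p, h.1) h.2 : Fin (k + 1) → Pos V N × V))).copy
    (congrArg (adj G) (congrFun (evader_cons (p, h.1) h.2) (Fin.last k)))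

/-- The strategy of the pursuer that moves by `π`, and continues by `σ p` after the move `p`. -/
def PursuerStrategy.cons (π : PursuerOneStep G s) (σ : ∀ p : Pos V N, PursuerStrategy G t p) :
    PursuerStrategy G (t + 1) s :=
  Fin.cases (fun _ => ⟨π.1, π.2⟩)
    (fun k m => (σ (m (0 : Fin (k + 1))) k (Fin.tail (n := k) (α := fun _ => Pos V N) m)).copy
      (congrArg (adjPos G)
        (congrFun (Fin.cons_self_tail (n := k) (α := fun _ => Pos V N) m) (Fin.last k))))

theorem PursuerStrategy.head_cons (π : PursuerOneStep G s) (σ : ∀ p : Pos V N, PursuerStrategy G t p) :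
    (PursuerStrategy.cons π σ).head = π :=
  rfl

theorem PursuerStrategy.tail_cons (π : PursuerOneStep G s) (σ : ∀ p : Pos V N, PursuerStrategy G t p)
    (p : Pos V N) : (PursuerStrategy.cons π σ).tail p = σ p :=
  rfl

/-- The strategy of the evader that moves by `π`, and continues by `σ p` after the first move `p`
of the pursuer. -/
def EvaderStrategy.cons (π : EvaderOneStep G) (σ : Pos V N → EvaderStrategy G N t) :
    EvaderStrategy G N (t + 1) :=
  Fin.cases (fun h => ⟨(π h.1).1, (π h.1).2⟩)
    (fun k h => (σ (h.2 (0 : Fin (k + 1))).1 k ((h.2 (0 : Fin (k + 1))).2,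
        Fin.tail (n := k) (α := fun _ => Pos V N × V) h.2)).copy
      (congrArg (adj G) (congrFun (Fin.cons_self_tail (n := k) (α := fun _ => V)
        fun i => (h.2 i).2) (Fin.last k))))

theorem EvaderStrategy.head_cons (π : EvaderOneStep G) (σ : Pos V N → EvaderStrategy G N t) :
    (EvaderStrategy.cons π σ).head = π :=
  rfl

/-- The start vertex is forgotten: the game after round one depends only on the pursuer's move and
her new vertex, and strategies of this form suffice for optimality. -/
theorem EvaderStrategy.tail_cons (π : EvaderOneStep G) (σ : Pos V N → EvaderStrategy G N t)
    (e : V) (p : Pos V N) : (EvaderStrategy.cons π σ).tail e p = σ p :=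
  rfl

/-! ### The payoff recursion for a fixed start vertex -/

/-- The probability of the moves in `h`, given its initial vertex. -/
def playProb (σp : PursuerStrategy G t s) (σe : EvaderStrategy G N t) {τ : ℕ} (hτ : τ ≤ t)
    (h : History V N τ) : ℝ :=
  ∏ k : Fin τ,
    (σp (Fin.castLE hτ k) (pursuerMoves (h.upTo k k.2.le))).prob (h.2 k).1 *
      (σe (Fin.castLE hτ k) (h.upTo k k.2.le)).prob (h.2 k).2

open Classical in
/-- The contribution of `h` to the expected utility if the evader starts at its initial vertex. -/
def playUtility (γ : ℝ) (σp : PursuerStrategy G t s) (σe : EvaderStrategy G N t) {τ : ℕ}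
    (hτ : τ ≤ t) (h : History V N τ) : ℝ :=
  if IsTerminal G t s h then playProb σp σe hτ h * utility γ s h else 0

/-- The pursuer's expected utility if the evader starts at `e`. -/
def utilityFrom (γ : ℝ) (σp : PursuerStrategy G t s) (σe : EvaderStrategy G N t) (e : V) : ℝ :=
  ∑ τ : Fin (t + 1), ∑ m : Fin τ → Pos V N × V,
    playUtility γ σp σe (Nat.le_of_lt_succ τ.2) (e, m)

theorem expectedUtility_eq_sum (γ : ℝ) (b : Belief V) (σp : PursuerStrategy G t s)
    (σe : EvaderStrategy G N t) :
    expectedUtility γ b σp σe = ∑ e, b.1 e * utilityFrom γ σp σe e := by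
  classical
  simp only [expectedUtility, utilityFrom, Finset.mul_sum]
  rw [Finset.sum_comm]
  refine Finset.sum_congr rfl fun τ _ => ?_
  rw [Finset.sum_filter, Fintype.sum_prod_type]
  refine Finset.sum_congr rfl fun e _ => Finset.sum_congr rfl fun m _ => ?_
  simp only [playUtility]
  split_ifs
  · exact mul_assoc _ _ _
  · simp

/-- The history that starts at `e` and continues with the moves `p` and `e'` and then by `m`. -/
def consHistory {τ : ℕ} (e : V) (x : Pos V N × V) (m : Fin τ → Pos V N × V) :
    History V N (τ + 1) :=
  (e, Fin.cons x m)

theorem playProb_consHistory (σp : PursuerStrategy G (t + 1) s)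
    (σe : EvaderStrategy G N (t + 1)) {τ : ℕ} (hτ : τ + 1 ≤ t + 1) (e : V) (x : Pos V N × V)
    (m : Fin τ → Pos V N × V) :
    playProb σp σe hτ (consHistory e x m) = σp.head.prob x.1 * (σe.head e).prob x.2 *
      playProb (σp.tail x.1) (σe.tail e x.1) (Nat.le_of_succ_le_succ hτ) (x.2, m) := by
  -- The first information sets are indexed by functions on `Fin 0`, which all equal the one used in
  -- `head`.
  have hm : ∀ m' : Fin 0 → Pos V N, m' = Fin.elim0 := fun _ => Subsingleton.elim _ _
  have hh : ∀ m' : Fin 0 → Pos V N × V, m' = Fin.elim0 := fun _ => Subsingleton.elim _ _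
  rw [playProb, Fin.prod_univ_succ]
  congr 1
  · congr 1
    · exact congrArg (fun m' => (σp 0 m').prob x.1) (hm _)
    · exact congrArg (fun m' => (σe 0 (e, m')).prob x.2) (hh _)
  · refine Finset.prod_congr rfl fun k _ => ?_
    have h1 : pursuerMoves ((consHistory e x m).upTo (k + 1) k.succ.2.le) =
        (Fin.cons x.1 (pursuerMoves (History.upTo (N := N) (x.2, m) k k.2.le)) :
          Fin (k + 1) → Pos V N) := by
      funext i
      refine Fin.cases rfl (fun j => rfl) i
    have h2 : (consHistory e x m).upTo (k + 1) k.succ.2.le =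
        (e, (Fin.cons (x.1, x.2) (History.upTo (N := N) (x.2, m) k k.2.le).2 :
          Fin (k + 1) → Pos V N × V)) := by
      refine Prod.ext rfl (funext fun i => ?_)
      refine Fin.cases rfl (fun j => rfl) i
    congr 1
    · exact congrArg
        (fun m' => (σp (Fin.castLE (Nat.le_of_succ_le_succ hτ) k).succ m').prob (m k).1) h1
    · exact congrArg
        (fun m' => (σe (Fin.castLE (Nat.le_of_succ_le_succ hτ) k).succ m').prob (m k).2) h2

omit [Fintype V] in
theorem caughtAtEnd_consHistory {τ : ℕ} (e : V) (x : Pos V N × V) (m : Fin τ → Pos V N × V) :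
    CaughtAtEnd s (consHistory e x m) ↔ CaughtAtEnd x.1 (x.2, m) := by
  simp only [CaughtAtEnd, evaderPath, consHistory]
  rw [pursuerMoves_cons e x.2, evader_cons]
  rfl

omit [Fintype V] in
theorem isHistory_consHistory {τ : ℕ} (e : V) (x : Pos V N × V) (m : Fin τ → Pos V N × V) :
    IsHistory G s (consHistory e x m) ↔ x.1 ∈ adjPos G s ∧ x.2 ∈ adj G e ∧ ¬ Caught s e ∧
      IsHistory G x.1 (x.2, m) := by
  unfold IsHistory
  simp only [evaderPath, consHistory]
  rw [pursuerMoves_cons e x.2, evader_cons, Fin.forall_fin_succ]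
  constructor
  · rintro ⟨⟨a, b, c⟩, d⟩
    exact ⟨a, b, c, d⟩
  · rintro ⟨a, b, c, d⟩
    exact ⟨⟨a, b, c⟩, d⟩

omit [Fintype V] in
theorem utility_consHistory (γ : ℝ) {τ : ℕ} (e : V) (x : Pos V N × V)
    (m : Fin τ → Pos V N × V) :
    utility γ s (consHistory e x m) = γ * utility γ x.1 ((x.2, m) : History V N τ) := by
  simp only [utility]
  by_cases h : CaughtAtEnd x.1 (x.2, m)
  · rw [if_pos h, if_pos ((caughtAtEnd_consHistory e x m).2 h), pow_succ']
  · rw [if_neg h, if_neg (mt (caughtAtEnd_consHistory e x m).1 h), mul_zero]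

theorem playUtility_consHistory (γ : ℝ) (σp : PursuerStrategy G (t + 1) s)
    (σe : EvaderStrategy G N (t + 1)) {τ : ℕ} (hτ : τ + 1 ≤ t + 1) {e : V} (he : ¬ Caught s e)
    (x : Pos V N × V) (m : Fin τ → Pos V N × V) :
    playUtility γ σp σe hτ (consHistory e x m) =
      γ * (σp.head.prob x.1 * (σe.head e).prob x.2 *
        playUtility γ (σp.tail x.1) (σe.tail e x.1) (Nat.le_of_succ_le_succ hτ) (x.2, m)) := by
  -- After a first move off the graph the left side vanishes because the list is no history, the
  -- right side because the move has probability zero.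
  by_cases h1 : x.1 ∈ adjPos G s
  · by_cases h2 : x.2 ∈ adj G e
    · have : IsTerminal G (t + 1) s (consHistory e x m) ↔
          IsTerminal (N := N) G t x.1 (x.2, m) := by
        simp [IsTerminal, caughtAtEnd_consHistory, isHistory_consHistory, h1, h2, he]
      rw [playUtility, playUtility]
      by_cases h : IsTerminal (N := N) G t x.1 (x.2, m)
      · rw [if_pos h, if_pos (this.2 h), playProb_consHistory, utility_consHistory]
        ring
      · rw [if_neg h, if_neg (mt this.1 h)]
        ring
    · have : ¬ IsTerminal G (t + 1) s (consHistory e x m) := fun h =>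
        h2 ((isHistory_consHistory e x m).1 h.1).2.1
      rw [playUtility, if_neg this, (σe.head e).prob_eq_zero h2]
      ring
  · have : ¬ IsTerminal G (t + 1) s (consHistory e x m) := fun h =>
      h1 ((isHistory_consHistory e x m).1 h.1).1
    rw [playUtility, if_neg this, σp.head.prob_eq_zero h1]
    ring

theorem playUtility_zero_of_caught (γ : ℝ) (σp : PursuerStrategy G t s)
    (σe : EvaderStrategy G N t) {e : V} (he : Caught s e) (m : Fin 0 → Pos V N × V) :
    playUtility γ σp σe (Nat.zero_le t) (e, m) = 1 := by
  have h : CaughtAtEnd s ((e, m) : History V N 0) := he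
  rw [playUtility, if_pos ⟨fun i => i.elim0, Or.inl h⟩, utility, if_pos h]
  simp [playProb]

theorem playUtility_zero_of_not_caught (γ : ℝ) (σp : PursuerStrategy G t s)
    (σe : EvaderStrategy G N t) {e : V} (he : ¬ Caught s e) (m : Fin 0 → Pos V N × V) :
    playUtility γ σp σe (Nat.zero_le t) (e, m) = 0 := by
  have h : ¬ CaughtAtEnd s ((e, m) : History V N 0) := he
  rw [playUtility, utility, if_neg h]
  simp

theorem playUtility_succ_of_caught (γ : ℝ) (σp : PursuerStrategy G t s)
    (σe : EvaderStrategy G N t) {e : V} (he : Caught s e) {τ : ℕ} (hτ : τ + 1 ≤ t)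
    (m : Fin (τ + 1) → Pos V N × V) :
    playUtility γ σp σe hτ (e, m) = 0 := by
  rw [playUtility, if_neg]
  exact fun h => (h.1 0).2.2 he

theorem utilityFrom_of_caught (γ : ℝ) (σp : PursuerStrategy G t s) (σe : EvaderStrategy G N t)
    {e : V} (he : Caught s e) : utilityFrom γ σp σe e = 1 := by
  rw [utilityFrom, Fin.sum_univ_succ, Finset.sum_eq_zero (s := Finset.univ (α := Fin t)), add_zero]
  · exact (Fintype.sum_unique (ι := Fin 0 → Pos V N × V) _).trans
      (playUtility_zero_of_caught γ σp σe he _)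
  · exact fun τ _ => Finset.sum_eq_zero fun m _ => playUtility_succ_of_caught γ σp σe he _ m

theorem utilityFrom_zero (γ : ℝ) (σp : PursuerStrategy G 0 s) (σe : EvaderStrategy G N 0)
    {e : V} (he : ¬ Caught s e) : utilityFrom γ σp σe e = 0 := by
  refine (Fintype.sum_unique (ι := Fin 1) _).trans ?_
  exact Finset.sum_eq_zero fun m _ => playUtility_zero_of_not_caught γ σp σe he m

/-- The empty history pays nothing at a free vertex, and every other one splits into its first round
and a history of the shorter game, whose payoff is discounted once more. The first moves are
independent because they are simultaneous. -/
theorem utilityFrom_succ (γ : ℝ) (σp : PursuerStrategy G (t + 1) s)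
    (σe : EvaderStrategy G N (t + 1)) {e : V} (he : ¬ Caught s e) :
    utilityFrom γ σp σe e = γ * ∑ p, σp.head.prob p * ∑ e', (σe.head e).prob e' *
      utilityFrom γ (σp.tail p) (σe.tail e p) e' := by
  rw [utilityFrom, Fin.sum_univ_succ, Finset.sum_eq_zero (s := Finset.univ (α := Fin _ → _)),
    zero_add]
  · have key : ∀ τ : Fin (t + 1), ∑ m : Fin (τ + 1) → Pos V N × V,
        playUtility γ σp σe (Nat.le_of_lt_succ τ.succ.2) (e, m) =
        ∑ p, ∑ e', ∑ m : Fin τ → Pos V N × V, γ * (σp.head.prob p * (σe.head e).prob e' *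
        playUtility γ (σp.tail p) (σe.tail e p) (Nat.le_of_lt_succ τ.2) (e', m)) := by
      intro τ
      rw [← (Fin.consEquiv fun _ : Fin (τ + 1) => Pos V N × V).sum_comp,
        Fintype.sum_prod_type, Fintype.sum_prod_type]
      exact Finset.sum_congr rfl fun p _ => Finset.sum_congr rfl fun e' _ =>
        Finset.sum_congr rfl fun m _ => playUtility_consHistory γ σp σe _ he (p, e') m
    refine (Finset.sum_congr rfl fun τ _ => key τ).trans ?_
    simp only [utilityFrom, Finset.mul_sum]
    rw [Finset.sum_comm]
    refine Finset.sum_congr rfl fun p _ => ?_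
    rw [Finset.sum_comm]
    refine Finset.sum_congr rfl fun e' _ => Finset.sum_congr rfl fun τ _ =>
      Finset.sum_congr rfl fun m _ => ?_
    ring
  · exact fun m _ => playUtility_zero_of_not_caught γ σp σe he m

/-! ### One-step strategies -/

open Classical in
/-- The distribution concentrated at `a`. -/
def DistOn.dirac {α : Type*} [Fintype α] {A : Set α} (a : α) (ha : a ∈ A) : DistOn A :=
  ⟨Pi.single a 1, single_mem_stdSimplex ℝ a, fun b hb => by
    rw [Pi.single_eq_of_ne]
    rintro rfl
    exact hb ha⟩

theorem DistOn.sum_dirac_mul {α : Type*} [Fintype α] {A : Set α} (a : α) (ha : a ∈ A)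
    (f : α → ℝ) : ∑ c, (DistOn.dirac a ha).prob c * f c = f a := by
  classical
  rw [Finset.sum_eq_single a]
  · simp [DistOn.dirac, DistOn.prob]
  · intro c _ hc
    simp [DistOn.dirac, DistOn.prob, hc]
  · simp

theorem DistOn.sum_mul_le {α : Type*} [Fintype α] {A : Set α} (π : DistOn A) {f : α → ℝ} {c : ℝ}
    (h : ∀ a ∈ A, f a ≤ c) : ∑ a, π.prob a * f a ≤ c := by
  calc ∑ a, π.prob a * f a ≤ ∑ a, π.prob a * c := by
        refine Finset.sum_le_sum fun a _ => ?_
        by_cases ha : a ∈ A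
        · exact mul_le_mul_of_nonneg_left (h a ha) (π.prob_nonneg a)
        · simp [π.prob_eq_zero ha]
    _ = c := by rw [← Finset.sum_mul, π.sum_prob, one_mul]

theorem DistOn.le_sum_mul {α : Type*} [Fintype α] {A : Set α} (π : DistOn A) {f : α → ℝ} {c : ℝ}
    (h : ∀ a ∈ A, c ≤ f a) : c ≤ ∑ a, π.prob a * f a := by
  have := π.sum_mul_le (f := fun a => - f a) (c := - c) fun a ha => neg_le_neg (h a ha)
  simp only [mul_neg, Finset.sum_neg_distrib] at this
  exact neg_le_neg_iff.1 this

omit [Fintype V] in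
theorem adjPos_nonempty (hG : ∀ v, ∃ w, G.Adj v w) (s : Pos V N) : (adjPos G s).Nonempty :=
  ⟨fun i => (hG (s i)).choose, fun i => (hG (s i)).choose_spec⟩

theorem nonempty_pursuerOneStep (hG : ∀ v, ∃ w, G.Adj v w) (s : Pos V N) :
    Nonempty (PursuerOneStep G s) :=
  let ⟨p, hp⟩ := adjPos_nonempty hG s
  ⟨DistOn.dirac p hp⟩

theorem nonempty_pursuerStrategy (hG : ∀ v, ∃ w, G.Adj v w) (t : ℕ) (s : Pos V N) :
    Nonempty (PursuerStrategy G t s) :=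
  ⟨fun _ _ => (nonempty_pursuerOneStep hG _).some⟩

theorem nonempty_evaderOneStep (hG : ∀ v, ∃ w, G.Adj v w) : Nonempty (EvaderOneStep G) :=
  ⟨fun e => DistOn.dirac _ (hG e).choose_spec⟩

/-! ### Payoff vectors guaranteed by the pursuer -/

/-- The cone of pairs `(r, x)` such that `x` is at most `r` times a vector of expected utilities
(indexed by the initial vertex of the evader) that the pursuer can guarantee in the horizon-`t`
game. -/
def guarantees (G : Digraph V) (γ : ℝ) {N : ℕ} : ℕ → Pos V N → Set (ℝ × (V → ℝ))
  | 0, s => {z | 0 ≤ z.1 ∧ (∀ e, 0 ≤ z.2 e ∧ z.2 e ≤ z.1) ∧ ∀ e, ¬ Caught s e → z.2 e ≤ 0}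
  | t + 1, s => {z | 0 ≤ z.1 ∧ (∀ e, 0 ≤ z.2 e ∧ z.2 e ≤ z.1) ∧
      ∃ q : Pos V N → ℝ × (V → ℝ),
        ((∀ p, q p ∈ guarantees G γ t p) ∧ (∀ p, p ∉ adjPos G s → (q p).1 = 0) ∧
          ∑ p, (q p).1 = z.1) ∧
        ∀ e, ¬ Caught s e → ∀ e', G.Adj e e' → z.2 e ≤ γ * ∑ p, (q p).2 e'}

/-- Plans of the pursuer for the first round: the total probability `r` is distributed over his
moves, and a guaranteed vector of continuation utilities is chosen after each of them. -/
def plans (G : Digraph V) (γ : ℝ) {N : ℕ} (t : ℕ) (s : Pos V N) (r : ℝ) :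
    Set (Pos V N → ℝ × (V → ℝ)) :=
  {q | (∀ p, q p ∈ guarantees G γ t p) ∧ (∀ p, p ∉ adjPos G s → (q p).1 = 0) ∧
    ∑ p, (q p).1 = r}

theorem mem_guarantees_succ {z : ℝ × (V → ℝ)} :
    z ∈ guarantees G γ (t + 1) s ↔ 0 ≤ z.1 ∧ (∀ e, 0 ≤ z.2 e ∧ z.2 e ≤ z.1) ∧
      ∃ q ∈ plans G γ t s z.1,
        ∀ e, ¬ Caught s e → ∀ e', G.Adj e e' → z.2 e ≤ γ * ∑ p, (q p).2 e' :=
  Iff.rfl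

/-- In particular mass zero forces the zero vector, which settles all degenerate cases below. -/
theorem guarantees_bounds {z : ℝ × (V → ℝ)} (hz : z ∈ guarantees G γ t s) :
    0 ≤ z.1 ∧ ∀ e, 0 ≤ z.2 e ∧ z.2 e ≤ z.1 := by
  cases t with
  | zero => exact ⟨hz.1, hz.2.1⟩
  | succ t => exact ⟨hz.1, hz.2.1⟩

/-- All conditions are homogeneous linear in the vector and its witness plan, so witnesses add. With
scaling this gives convexity: a mixture of two plans is again a plan. -/
theorem add_mem_guarantees {z z' : ℝ × (V → ℝ)} (hz : z ∈ guarantees G γ t s)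
    (hz' : z' ∈ guarantees G γ t s) : z + z' ∈ guarantees G γ t s := by
  have h0 : 0 ≤ (z + z').1 := add_nonneg (guarantees_bounds hz).1 (guarantees_bounds hz').1
  have h1 : ∀ e, 0 ≤ (z + z').2 e ∧ (z + z').2 e ≤ (z + z').1 := fun e =>
    ⟨add_nonneg ((guarantees_bounds hz).2 e).1 ((guarantees_bounds hz').2 e).1,
      add_le_add ((guarantees_bounds hz).2 e).2 ((guarantees_bounds hz').2 e).2⟩
  induction t generalizing s z z' with
  | zero => exact ⟨h0, h1, fun e he => add_nonpos (hz.2.2 e he) (hz'.2.2 e he)⟩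
  | succ t ih =>
    obtain ⟨-, -, q, ⟨hq1, hq2, hq3⟩, hq⟩ := hz
    obtain ⟨-, -, q', ⟨hq1', hq2', hq3'⟩, hq'⟩ := hz'
    refine ⟨h0, h1, q + q', ⟨fun p => ih (hq1 p) (hq1' p) ?_ ?_, fun p hp => ?_, ?_⟩,
      fun e he e' hee => ?_⟩
    · exact add_nonneg (guarantees_bounds (hq1 p)).1 (guarantees_bounds (hq1' p)).1
    · exact fun e => ⟨add_nonneg ((guarantees_bounds (hq1 p)).2 e).1
        ((guarantees_bounds (hq1' p)).2 e).1,
        add_le_add ((guarantees_bounds (hq1 p)).2 e).2 ((guarantees_bounds (hq1' p)).2 e).2⟩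
    · simp [hq2 p hp, hq2' p hp]
    · simp [Finset.sum_add_distrib, hq3, hq3']
    · simp only [Pi.add_apply, Prod.snd_add, Finset.sum_add_distrib, mul_add]
      exact add_le_add (hq e he e' hee) (hq' e he e' hee)

theorem smul_mem_guarantees {z : ℝ × (V → ℝ)} (hz : z ∈ guarantees G γ t s) {c : ℝ}
    (hc : 0 ≤ c) : c • z ∈ guarantees G γ t s := by
  have h0 : 0 ≤ (c • z).1 := mul_nonneg hc (guarantees_bounds hz).1
  have h1 : ∀ e, 0 ≤ (c • z).2 e ∧ (c • z).2 e ≤ (c • z).1 := fun e =>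
    ⟨mul_nonneg hc ((guarantees_bounds hz).2 e).1,
      mul_le_mul_of_nonneg_left ((guarantees_bounds hz).2 e).2 hc⟩
  induction t generalizing s z with
  | zero => exact ⟨h0, h1, fun e he => mul_nonpos_of_nonneg_of_nonpos hc (hz.2.2 e he)⟩
  | succ t ih =>
    obtain ⟨-, -, q, ⟨hq1, hq2, hq3⟩, hq⟩ := hz
    refine ⟨h0, h1, c • q, ⟨fun p => ih (hq1 p) ?_ ?_, fun p hp => ?_, ?_⟩,
      fun e he e' hee => ?_⟩
    · exact mul_nonneg hc (guarantees_bounds (hq1 p)).1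
    · exact fun e => ⟨mul_nonneg hc ((guarantees_bounds (hq1 p)).2 e).1,
        mul_le_mul_of_nonneg_left ((guarantees_bounds (hq1 p)).2 e).2 hc⟩
    · simp [hq2 p hp]
    · simp [← Finset.mul_sum, hq3]
    · simp only [Pi.smul_apply, Prod.smul_snd, smul_eq_mul, ← Finset.mul_sum]
      rw [mul_left_comm]
      exact mul_le_mul_of_nonneg_left (hq e he e' hee) hc

/-- Utility zero is secured by any legal play. Mass zero is included, to fill the unused moves of a
plan. -/
theorem const_mem_guarantees (hG : ∀ v, ∃ w, G.Adj v w) (t : ℕ) (s : Pos V N) {r : ℝ}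
    (hr : 0 ≤ r) : (r, 0) ∈ guarantees G γ t s := by
  induction t generalizing s r with
  | zero => exact ⟨hr, fun e => ⟨le_rfl, hr⟩, fun e _ => le_rfl⟩
  | succ t ih =>
    obtain ⟨π⟩ := nonempty_pursuerOneStep hG s
    refine ⟨hr, fun e => ⟨le_rfl, hr⟩, fun p => (r * π.prob p, 0),
      ⟨fun p => ih p (mul_nonneg hr (π.prob_nonneg p)), fun p hp => ?_, ?_⟩, ?_⟩
    · simp [π.prob_eq_zero hp]
    · simp [← Finset.mul_sum, π.sum_prob]
    · simp

theorem plans_nonempty (hG : ∀ v, ∃ w, G.Adj v w) (t : ℕ) (s : Pos V N) :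
    (plans G γ t s 1).Nonempty := by
  obtain ⟨-, -, q, hq, -⟩ := const_mem_guarantees (γ := γ) hG (t + 1) s zero_le_one
  exact ⟨q, hq⟩

theorem convex_plans (t : ℕ) (s : Pos V N) (r : ℝ) : Convex ℝ (plans G γ t s r) := by
  intro q hq q' hq' a b ha hb hab
  refine ⟨fun p => add_mem_guarantees (smul_mem_guarantees (hq.1 p) ha)
    (smul_mem_guarantees (hq'.1 p) hb), fun p hp => ?_, ?_⟩
  · simp [hq.2.1 p hp, hq'.2.1 p hp]
  · simp only [Pi.add_apply, Pi.smul_apply, Prod.fst_add, Prod.smul_fst, smul_eq_mul,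
      Finset.sum_add_distrib, ← Finset.mul_sum, hq.2.2, hq'.2.2]
    rw [← add_mul, hab, one_mul]

theorem guarantees_subset_Icc :
    guarantees G γ t s ∩ {z | z.1 ≤ 1} ⊆ Set.Icc (0 : ℝ × (V → ℝ)) 1 := by
  rintro z ⟨hz, hz1⟩
  have h := guarantees_bounds hz
  exact ⟨⟨h.1, fun e => (h.2 e).1⟩, ⟨hz1, fun e => (h.2 e).2.trans hz1⟩⟩

theorem plans_subset {r : ℝ} (hr : r ≤ 1) : plans G γ t s r ⊆
    Set.univ.pi fun p => guarantees G γ t p ∩ {z | z.1 ≤ 1} := by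
  intro q hq p _
  refine ⟨hq.1 p, ?_⟩
  have : (q p).1 ≤ ∑ p, (q p).1 :=
    Finset.single_le_sum (f := fun p => (q p).1) (fun p _ => (guarantees_bounds (hq.1 p)).1)
      (Finset.mem_univ p)
  rw [hq.2.2] at this
  exact this.trans hr

/-- The witness plan of a vector of mass at most 1 has components of mass at most 1, which range
over a compact set by induction. The new set is thus the projection of a closed subset of a compact
product. -/
theorem isCompact_guarantees (t : ℕ) (s : Pos V N) :
    IsCompact (guarantees G γ t s ∩ {z | z.1 ≤ 1}) := by
  induction t generalizing s with
  | zero =>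
    refine isCompact_Icc.of_isClosed_subset ?_ guarantees_subset_Icc
    simp only [guarantees, Set.ofPred_and, Set.ofPred_forall]
    refine (IsClosed.inter ?_ (IsClosed.inter ?_ ?_)).inter ?_
    · exact isClosed_le (by fun_prop) (by fun_prop)
    · exact isClosed_iInter fun e => (isClosed_le (by fun_prop) (by fun_prop)).inter
        (isClosed_le (by fun_prop) (by fun_prop))
    · exact isClosed_iInter fun e => isClosed_iInter fun _ =>
        isClosed_le (by fun_prop) (by fun_prop)
    · exact isClosed_le (by fun_prop) (by fun_prop)
  | succ t ih =>
    have hK : IsCompact (Set.Icc (0 : ℝ × (V → ℝ)) 1 ×ˢ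
        Set.univ.pi fun p : Pos V N => guarantees G γ t p ∩ {z | z.1 ≤ 1}) :=
      isCompact_Icc.prod (isCompact_univ_pi ih)
    let C : Set ((ℝ × (V → ℝ)) × (Pos V N → ℝ × (V → ℝ))) :=
      {y | (∀ e, y.1.2 e ≤ y.1.1) ∧ (∀ p, p ∉ adjPos G s → (y.2 p).1 = 0) ∧
        ∑ p, (y.2 p).1 = y.1.1 ∧
        ∀ e, ¬ Caught s e → ∀ e', G.Adj e e' → y.1.2 e ≤ γ * ∑ p, (y.2 p).2 e'}
    have hC : IsClosed C := by
      simp only [C, Set.ofPred_and, Set.ofPred_forall]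
      refine IsClosed.inter ?_ (IsClosed.inter ?_ (IsClosed.inter ?_ ?_))
      · exact isClosed_iInter fun e => isClosed_le (by fun_prop) (by fun_prop)
      · exact isClosed_iInter fun p => isClosed_iInter fun _ =>
          isClosed_eq (by fun_prop) (by fun_prop)
      · exact isClosed_eq (by fun_prop) (by fun_prop)
      · exact isClosed_iInter fun e => isClosed_iInter fun _ => isClosed_iInter fun e' =>
          isClosed_iInter fun _ => isClosed_le (by fun_prop) (by fun_prop)
    convert (hK.inter_right hC).image continuous_fst using 1
    ext z
    constructor
    · rintro ⟨hz, hz1⟩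
      obtain ⟨-, h2, q, hq, h3⟩ := mem_guarantees_succ.1 hz
      exact ⟨(z, q), ⟨⟨guarantees_subset_Icc ⟨hz, hz1⟩, plans_subset hz1 hq⟩,
        fun e => (h2 e).2, hq.2.1, hq.2.2, h3⟩, rfl⟩
    · rintro ⟨⟨z, q⟩, ⟨⟨hz, hq⟩, h1, h2, h3, h4⟩, rfl⟩
      exact ⟨⟨hz.1.1, fun e => ⟨hz.1.2 e, h1 e⟩, q,
        ⟨fun p => (hq p trivial).1, h2, h3⟩, h4⟩, hz.2.1⟩

theorem isCompact_plans (t : ℕ) (s : Pos V N) : IsCompact (plans G γ t s 1) := by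
  have : plans G γ t s 1 = (Set.univ.pi fun p => guarantees G γ t p ∩ {z | z.1 ≤ 1}) ∩
      {q | (∀ p, p ∉ adjPos G s → (q p).1 = 0) ∧ ∑ p, (q p).1 = 1} := by
    ext q
    exact ⟨fun h => ⟨plans_subset le_rfl h, h.2⟩, fun h => ⟨fun p => (h.1 p trivial).1, h.2⟩⟩
  rw [this]
  refine (isCompact_univ_pi fun p => isCompact_guarantees t p).inter_right ?_
  simp only [Set.ofPred_and, Set.ofPred_forall]
  exact (isClosed_iInter fun p => isClosed_iInter fun _ =>
    isClosed_eq (by fun_prop) (by fun_prop)).inter (isClosed_eq (by fun_prop) (by fun_prop))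

/-- The vectors of expected utilities guaranteed by the pursuer. -/
def guaranteed (G : Digraph V) (γ : ℝ) {N : ℕ} (t : ℕ) (s : Pos V N) : Set (V → ℝ) :=
  {x | (1, x) ∈ guarantees G γ t s}

theorem isCompact_guaranteed (t : ℕ) (s : Pos V N) : IsCompact (guaranteed G γ t s) := by
  have : guaranteed G γ t s =
      Prod.snd '' ((guarantees G γ t s ∩ {z | z.1 ≤ 1}) ∩ {z | z.1 = 1}) := by
    ext x
    constructor
    · intro hx
      exact ⟨(1, x), ⟨⟨hx, le_refl (1 : ℝ)⟩, rfl⟩, rfl⟩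
    · rintro ⟨⟨r, y⟩, ⟨⟨hz, -⟩, hr⟩, rfl⟩
      obtain rfl : r = 1 := hr
      exact hz
  rw [this]
  exact ((isCompact_guarantees t s).inter_right
    (isClosed_eq (by fun_prop) (by fun_prop))).image continuous_snd

theorem guaranteed_nonempty (hG : ∀ v, ∃ w, G.Adj v w) (t : ℕ) (s : Pos V N) :
    (guaranteed G γ t s).Nonempty :=
  ⟨0, const_mem_guarantees hG t s zero_le_one⟩

/-- The largest guaranteed expected utility, for the (unnormalized) belief `β`. -/
def maxmin (G : Digraph V) (γ : ℝ) {N : ℕ} (t : ℕ) (s : Pos V N) (β : V → ℝ) : ℝ :=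
  sSup ((fun x : V → ℝ => ∑ e, β e * x e) '' guaranteed G γ t s)

/-- Needed for the minima over `π_e` in the update formula to be attained. -/
theorem continuous_maxmin (t : ℕ) (s : Pos V N) : Continuous (maxmin G γ t s) :=
  (isCompact_guaranteed t s).continuous_sSup
    (f := fun (β : V → ℝ) (x : V → ℝ) => ∑ e, β e * x e) (by
      simp only [Function.HasUncurry.uncurry, id]
      fun_prop)

theorem exists_maxmin (hG : ∀ v, ∃ w, G.Adj v w) (t : ℕ) (s : Pos V N) (β : V → ℝ) :
    ∃ x ∈ guaranteed G γ t s, maxmin G γ t s β = ∑ e, β e * x e ∧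
      ∀ y ∈ guaranteed G γ t s, ∑ e, β e * y e ≤ ∑ e, β e * x e :=
  (isCompact_guaranteed t s).exists_sSup_image_eq_and_ge (guaranteed_nonempty hG t s)
    (by fun_prop)

/-- For positive mass, dividing by it gives a vector in `guaranteed`; for mass zero both sides are
zero. -/
theorem le_maxmin (hG : ∀ v, ∃ w, G.Adj v w) (β : V → ℝ) {z : ℝ × (V → ℝ)}
    (hz : z ∈ guarantees G γ t s) : ∑ e, β e * z.2 e ≤ z.1 * maxmin G γ t s β := by
  obtain ⟨x, -, hx, hmax⟩ := exists_maxmin (γ := γ) hG t s β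
  have hb := guarantees_bounds hz
  rcases hb.1.eq_or_lt with h | h
  · have : ∀ e, z.2 e = 0 := fun e => le_antisymm (h ▸ (hb.2 e).2) (hb.2 e).1
    simp [this, ← h]
  · have h1 := smul_mem_guarantees hz (inv_nonneg.2 h.le)
    have h2 : z.1⁻¹ • z.2 ∈ guaranteed G γ t s := by
      have : (1, z.1⁻¹ • z.2) = z.1⁻¹ • z := by
        ext <;> simp [h.ne']
      rwa [guaranteed, Set.mem_ofPred_eq, this]
    have h3 := hmax _ h2
    rw [hx, ← div_le_iff₀' h]
    refine le_trans (le_of_eq ?_) h3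
    simp only [Pi.smul_apply, smul_eq_mul, div_eq_inv_mul, Finset.mul_sum]
    exact Finset.sum_congr rfl fun e _ => by ring

/-- Homogeneity allows unnormalized beliefs such as `spread`, and so avoids the division by
`freeMass`. -/
theorem maxmin_smul (hG : ∀ v, ∃ w, G.Adj v w) (β : V → ℝ) {c : ℝ} (hc : 0 ≤ c) :
    maxmin G γ t s (c • β) = c * maxmin G γ t s β := by
  obtain ⟨x, hx, h1, -⟩ := exists_maxmin (γ := γ) hG t s (c • β)
  obtain ⟨y, hy, h2, -⟩ := exists_maxmin (γ := γ) hG t s β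
  have h3 := le_maxmin hG β hx
  have h4 := le_maxmin hG (c • β) hy
  simp only [one_mul, Pi.smul_apply, smul_eq_mul, mul_assoc, ← Finset.mul_sum] at h1 h3 h4
  refine le_antisymm ?_ ?_
  · rw [h1]
    exact mul_le_mul_of_nonneg_left h3 hc
  · rw [h2]
    exact h4

/-! ### The saddle point of the first round -/

/-- The set of one-step strategies of the evader, as a subset of a vector space. -/
def evaderSet (G : Digraph V) : Set (V → V → ℝ) :=
  {π | ∀ e, π e ∈ stdSimplex ℝ V ∧ ∀ a, a ∉ adj G e → π e a = 0}

/-- The one-step strategy of the evader given by an element of `evaderSet`. -/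
def evaderOneStepOf {π : V → V → ℝ} (hπ : π ∈ evaderSet G) : EvaderOneStep G :=
  fun e => ⟨π e, hπ e⟩

theorem coe_mem_evaderSet (π : EvaderOneStep G) : (fun e => (π e).prob) ∈ evaderSet G :=
  fun e => (π e).2

theorem isCompact_evaderSet : IsCompact (evaderSet G) := by
  have : evaderSet G = (Set.univ.pi fun _ => stdSimplex ℝ V) ∩
      {π | ∀ e, ∀ a, a ∉ adj G e → π e a = 0} := by
    ext π
    exact ⟨fun h => ⟨fun e _ => (h e).1, fun e => (h e).2⟩,
      fun h e => ⟨h.1 e trivial, h.2 e⟩⟩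
  rw [this]
  refine (isCompact_univ_pi fun _ => isCompact_stdSimplex ℝ V).inter_right ?_
  simp only [Set.ofPred_forall]
  exact isClosed_iInter fun e => isClosed_iInter fun a => isClosed_iInter fun _ =>
    isClosed_eq (by fun_prop) (by fun_prop)

theorem convex_evaderSet : Convex ℝ (evaderSet G) := by
  intro π hπ π' hπ' a b ha hb hab e
  refine ⟨convex_stdSimplex ℝ V (hπ e).1 (hπ' e).1 ha hb hab, fun c hc => ?_⟩
  simp [(hπ e).2 c hc, (hπ' e).2 c hc]

theorem evaderSet_nonempty (hG : ∀ v, ∃ w, G.Adj v w) : (evaderSet G).Nonempty :=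
  let ⟨π⟩ := nonempty_evaderOneStep hG
  ⟨_, coe_mem_evaderSet π⟩

/-- The (unnormalized) belief after a move of the evader. -/
def spread (β : V → ℝ) (π : V → V → ℝ) (e' : V) : ℝ := ∑ e, β e * π e e'

theorem continuous_spread (β : V → ℝ) : Continuous (spread β) := by
  unfold spread
  fun_prop

/-- The expected continuation utility guaranteed by a plan of the pursuer. -/
def planPayoff {N : ℕ} (β : V → ℝ) (π : V → V → ℝ) (q : Pos V N → ℝ × (V → ℝ)) : ℝ :=
  ∑ p, ∑ e', spread β π e' * (q p).2 e'

/-- Sion's theorem for a bilinear payoff. The choices `π' = π` and `q' = q` give the two separate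
optimality statements. -/
theorem exists_saddle (hG : ∀ v, ∃ w, G.Adj v w) (γ : ℝ) (t : ℕ) (s : Pos V N) (β : V → ℝ) :
    ∃ π ∈ evaderSet G, ∃ q ∈ plans G γ t s 1, ∀ π' ∈ evaderSet G, ∀ q' ∈ plans G γ t s 1,
      planPayoff β π q' ≤ planPayoff β π' q := by
  have hlin1 : ∀ q : Pos V N → ℝ × (V → ℝ), ∀ (π π' : V → V → ℝ) (a b : ℝ),
      planPayoff β (a • π + b • π') q = a * planPayoff β π q + b * planPayoff β π' q := by
    intro q π π' a b
    simp only [planPayoff, spread, Finset.mul_sum, Finset.sum_mul, ← Finset.sum_add_distrib,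
      Pi.add_apply, Pi.smul_apply, smul_eq_mul]
    refine Finset.sum_congr rfl fun _ _ => Finset.sum_congr rfl fun _ _ =>
      Finset.sum_congr rfl fun _ _ => ?_
    ring
  have hlin2 : ∀ π : V → V → ℝ, ∀ (q q' : Pos V N → ℝ × (V → ℝ)) (a b : ℝ),
      planPayoff β π (a • q + b • q') = a * planPayoff β π q + b * planPayoff β π q' := by
    intro π q q' a b
    simp only [planPayoff, Finset.mul_sum, ← Finset.sum_add_distrib,
      Pi.add_apply, Pi.smul_apply, smul_eq_mul, Prod.snd_add, Prod.smul_snd]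
    refine Finset.sum_congr rfl fun _ _ => Finset.sum_congr rfl fun _ _ => ?_
    ring
  refine Sion.exists_isSaddlePointOn (evaderSet_nonempty hG) convex_evaderSet isCompact_evaderSet
    (fun q _ => (Continuous.lowerSemicontinuous ?_).lowerSemicontinuousOn _)
    (fun q _ => ConvexOn.quasiconvexOn ⟨convex_evaderSet, fun π _ π' _ a b _ _ _ =>
      (hlin1 q π π' a b).le⟩)
    (convex_plans t s 1) (plans_nonempty hG t s) (isCompact_plans t s)
    (fun π _ => (Continuous.upperSemicontinuous ?_).upperSemicontinuousOn _)
    (fun π _ => ConcaveOn.quasiconcaveOn ⟨convex_plans t s 1, fun q _ q' _ a b _ _ _ =>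
      (hlin2 π q q' a b).ge⟩)
  · unfold planPayoff spread
    fun_prop
  · unfold planPayoff
    fun_prop

/-! ### Beliefs on the free vertices and one-round bounds for `maxmin` -/

open Classical in
/-- The belief restricted to the vertices that the pursuer does not occupy. -/
def freeWeight {N : ℕ} (s : Pos V N) (b : Belief V) (e : V) : ℝ := if Caught s e then 0 else b.1 e

theorem freeWeight_of_caught (b : Belief V) {e : V} (he : Caught s e) : freeWeight s b e = 0 :=
  if_pos he

theorem freeWeight_of_not_caught (b : Belief V) {e : V} (he : ¬ Caught s e) :
    freeWeight s b e = b.1 e :=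
  if_neg he

theorem freeWeight_nonneg (s : Pos V N) (b : Belief V) (e : V) : 0 ≤ freeWeight s b e := by
  by_cases he : Caught s e
  · rw [freeWeight_of_caught b he]
  · rw [freeWeight_of_not_caught b he]
    exact b.2.1 e

theorem freeMass_nonneg (s : Pos V N) (b : Belief V) : 0 ≤ freeMass s b :=
  Finset.sum_nonneg fun e _ => b.2.1 e

theorem caughtMass_nonneg (s : Pos V N) (b : Belief V) : 0 ≤ caughtMass s b :=
  Finset.sum_nonneg fun e _ => b.2.1 e

theorem caughtMass_add_freeMass (s : Pos V N) (b : Belief V) :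
    caughtMass s b + freeMass s b = 1 := by
  classical
  rw [← b.2.2]
  exact Finset.sum_filter_add_sum_filter_not _ _ _

theorem caughtMass_add_sum_freeWeight (b : Belief V) {x : V → ℝ}
    (hx : ∀ e, Caught s e → x e = 1) :
    caughtMass s b + ∑ e, freeWeight s b e * x e = ∑ e, b.1 e * x e := by
  classical
  rw [caughtMass, Finset.sum_filter, ← Finset.sum_add_distrib]
  refine Finset.sum_congr rfl fun e _ => ?_
  by_cases he : Caught s e
  · simp [he, freeWeight_of_caught b he, hx e he]
  · simp [he, freeWeight_of_not_caught b he]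

/-- It also holds if `freeMass` vanishes, both sides being zero, so the default belief does no harm.
-/
theorem freeMass_smul_transformedBelief (b : Belief V) (π : EvaderOneStep G) :
    freeMass s b • (transformedBelief s b π).1 =
      spread (freeWeight s b) fun e => (π e).prob := by
  classical
  have hs : ∀ e', spread (freeWeight s b) (fun e => (π e).prob) e' =
      ∑ e with ¬ Caught s e, b.1 e * (π e).prob e' := by
    intro e'
    rw [spread, Finset.sum_filter]
    refine Finset.sum_congr rfl fun e _ => ?_
    by_cases he : Caught s e
    · simp [he, freeWeight_of_caught b he]
    · simp [he, freeWeight_of_not_caught b he]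
  funext e'
  rw [hs, Pi.smul_apply, smul_eq_mul, transformedBelief]
  split_ifs with h
  · rw [h, zero_mul]
    refine (Finset.sum_eq_zero fun e he => ?_).symm
    rw [freeMass, Finset.sum_eq_zero_iff_of_nonneg fun e _ => b.2.1 e] at h
    rw [h e he, zero_mul]
  · simp only [transformedWeight]
    rw [← mul_assoc, mul_one_div_cancel h, one_mul]

theorem planPayoff_eq (β : V → ℝ) (π : V → V → ℝ) (q : Pos V N → ℝ × (V → ℝ)) :
    planPayoff β π q = ∑ e, β e * ∑ e', π e e' * ∑ p, (q p).2 e' := by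
  simp only [planPayoff, spread, Finset.sum_mul, Finset.mul_sum]
  rw [Finset.sum_comm_cycle]
  refine Finset.sum_congr rfl fun e _ => ?_
  rw [Finset.sum_comm]
  refine Finset.sum_congr rfl fun e' _ => Finset.sum_congr rfl fun p _ => ?_
  ring

/-- At a free vertex a guaranteed vector lies below the discounted plan value at every neighbour,
hence below the average under `π`. -/
theorem maxmin_succ_le (hG : ∀ v, ∃ w, G.Adj v w) (hγ : 0 ≤ γ) (b : Belief V) {c : ℝ}
    {π : V → V → ℝ} (hπ : π ∈ evaderSet G)
    (hc : ∀ q ∈ plans G γ t s 1, planPayoff (freeWeight s b) π q ≤ c) :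
    maxmin G γ (t + 1) s b.1 ≤ caughtMass s b + γ * c := by
  classical
  obtain ⟨x, hx, hmax, -⟩ := exists_maxmin (γ := γ) hG (t + 1) s b.1
  obtain ⟨-, hx1, q, hq, hxq⟩ := mem_guarantees_succ.1 hx
  rw [hmax]
  -- Raising the entries at occupied vertices to 1 makes their contribution exactly `caughtMass`.
  let y : V → ℝ := fun e => if Caught s e then 1 else x e
  calc ∑ e, b.1 e * x e ≤ ∑ e, b.1 e * y e := by
        refine Finset.sum_le_sum fun e _ => mul_le_mul_of_nonneg_left ?_ (b.2.1 e)
        by_cases he : Caught s e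
        · simpa [y, he] using (hx1 e).2
        · simp [y, he]
    _ = caughtMass s b + ∑ e, freeWeight s b e * y e :=
        (caughtMass_add_sum_freeWeight b fun e he => if_pos he).symm
    _ ≤ caughtMass s b + γ * planPayoff (freeWeight s b) π q := by
        rw [planPayoff_eq, Finset.mul_sum]
        refine add_le_add le_rfl (Finset.sum_le_sum fun e _ => ?_)
        rw [mul_left_comm]
        by_cases he : Caught s e
        · simp [freeWeight_of_caught b he]
        · refine mul_le_mul_of_nonneg_left ?_ (freeWeight_nonneg s b e)
          have := DistOn.le_sum_mul (evaderOneStepOf hπ e) (hxq e he)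
          rw [Finset.mul_sum]
          simp only [y, if_neg he]
          refine this.trans (le_of_eq (Finset.sum_congr rfl fun e' _ => ?_))
          exact mul_left_comm _ _ _
    _ ≤ _ := add_le_add le_rfl (mul_le_mul_of_nonneg_left (hc q hq) hγ)

theorem le_maxmin_succ (hG : ∀ v, ∃ w, G.Adj v w) (hγ : 0 ≤ γ) (hγ1 : γ ≤ 1) (b : Belief V)
    {c : ℝ} {q : Pos V N → ℝ × (V → ℝ)} (hq : q ∈ plans G γ t s 1)
    (hc : ∀ π ∈ evaderSet G, c ≤ planPayoff (freeWeight s b) π q) :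
    caughtMass s b + γ * c ≤ maxmin G γ (t + 1) s b.1 := by
  classical
  have hmin : ∀ e, ∃ e' ∈ adj G e, ∀ a ∈ adj G e, ∑ p, (q p).2 e' ≤ ∑ p, (q p).2 a := fun e =>
    Set.exists_min_image (adj G e) (fun a => ∑ p, (q p).2 a) (Set.toFinite _) (hG e)
  -- `g` is the evader's best pure reply to `q`. The vector `x` is the payoff against it, and `hc`
  -- is later applied to this reply.
  choose g hg hgmin using hmin
  let x : V → ℝ := fun e => if Caught s e then 1 else γ * ∑ p, (q p).2 (g e)
  have h0 : ∀ e', 0 ≤ ∑ p, (q p).2 e' := fun e' =>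
    Finset.sum_nonneg fun p _ => ((guarantees_bounds (hq.1 p)).2 e').1
  have h1 : ∀ e', ∑ p, (q p).2 e' ≤ 1 := fun e' => by
    rw [← hq.2.2]
    exact Finset.sum_le_sum fun p _ => ((guarantees_bounds (hq.1 p)).2 e').2
  have hx : ((1 : ℝ), x) ∈ guarantees G γ (t + 1) s := by
    refine mem_guarantees_succ.2 ⟨zero_le_one, fun e => ?_, q, hq, fun e he e' hee => ?_⟩
    · by_cases he : Caught s e
      · simp [x, he]
      · simp only [x, if_neg he]
        exact ⟨mul_nonneg hγ (h0 _), mul_le_one₀ hγ1 (h0 _) (h1 _)⟩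
    · simp only [x, if_neg he]
      exact mul_le_mul_of_nonneg_left (hgmin e e' hee) hγ
  have hle := le_maxmin hG b.1 hx
  rw [one_mul] at hle
  refine le_trans ?_ hle
  rw [← caughtMass_add_sum_freeWeight b (s := s) (x := x) fun e he => if_pos he]
  refine add_le_add le_rfl ?_
  refine (mul_le_mul_of_nonneg_left
    (hc _ (coe_mem_evaderSet fun e => DistOn.dirac (g e) (hg e))) hγ).trans (le_of_eq ?_)
  rw [planPayoff_eq, Finset.mul_sum]
  refine Finset.sum_congr rfl fun e _ => ?_
  rw [DistOn.sum_dirac_mul]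
  by_cases he : Caught s e
  · simp [freeWeight_of_caught b he]
  · simp only [x, if_neg he]
    ring

theorem maxmin_zero (hG : ∀ v, ∃ w, G.Adj v w) (b : Belief V) :
    maxmin G γ 0 s b.1 = caughtMass s b := by
  classical
  let x : V → ℝ := fun e => if Caught s e then 1 else 0
  have hx : ((1 : ℝ), x) ∈ guarantees G γ 0 s := by
    refine ⟨zero_le_one, fun e => ?_, fun e he => ?_⟩
    · by_cases he : Caught s e <;> simp [x, he]
    · simp [x, he]
  have hs : ∑ e, b.1 e * x e = caughtMass s b := by
    simp [x, caughtMass, Finset.sum_filter]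
  refine le_antisymm ?_ ?_
  · obtain ⟨y, hy, h, -⟩ := exists_maxmin (γ := γ) hG 0 s b.1
    rw [h, ← hs]
    refine Finset.sum_le_sum fun e _ => mul_le_mul_of_nonneg_left ?_ (b.2.1 e)
    by_cases he : Caught s e
    · simpa [x, he] using (hy.2.1 e).2
    · simpa [x, he] using hy.2.2 e he
  · have := le_maxmin hG b.1 hx
    rwa [one_mul, hs] at this

theorem maxmin_mem_Icc (hG : ∀ v, ∃ w, G.Adj v w) (t : ℕ) (s : Pos V N) (b : Belief V) :
    maxmin G γ t s b.1 ∈ Set.Icc (0 : ℝ) 1 := by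
  obtain ⟨x, hx, h, -⟩ := exists_maxmin (γ := γ) hG t s b.1
  have hb := (guarantees_bounds hx).2
  rw [h]
  refine ⟨Finset.sum_nonneg fun e _ => mul_nonneg (b.2.1 e) (hb e).1, ?_⟩
  rw [← b.2.2]
  exact Finset.sum_le_sum fun e _ => mul_le_of_le_one_right (b.2.1 e) (hb e).2

/-! ### Optimal strategies -/

/-- The masses of the witness plan, normalized, are the first move. The mass stays as a factor on
the right so that the induction hypothesis applies to every move, also to one of mass zero. -/
theorem exists_pursuerStrategy (hG : ∀ v, ∃ w, G.Adj v w) (hγ : 0 ≤ γ) {z : ℝ × (V → ℝ)}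
    (hz : z ∈ guarantees G γ t s) :
    ∃ σp : PursuerStrategy G t s, ∀ (σe : EvaderStrategy G N t) (e : V),
      z.2 e ≤ z.1 * utilityFrom γ σp σe e := by
  induction t generalizing s z with
  | zero =>
    refine ⟨fun k => k.elim0, fun σe e => ?_⟩
    by_cases he : Caught s e
    · rw [utilityFrom_of_caught γ _ σe he, mul_one]
      exact (hz.2.1 e).2
    · rw [utilityFrom_zero γ _ σe he, mul_zero]
      exact hz.2.2 e he
  | succ t ih =>
    obtain ⟨hz0, hz1, q, hq, hzq⟩ := mem_guarantees_succ.1 hz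
    rcases hz0.eq_or_lt with h | h
    · obtain ⟨σp⟩ := nonempty_pursuerStrategy hG (t + 1) s
      refine ⟨σp, fun σe e => ?_⟩
      rw [← h, zero_mul, h]
      exact (hz1 e).2
    · choose σ hσ using fun p => ih (hq.1 p)
      let π : PursuerOneStep G s := ⟨fun p => (q p).1 / z.1,
        ⟨fun p => div_nonneg (guarantees_bounds (hq.1 p)).1 hz0, by
          rw [← Finset.sum_div, hq.2.2, div_self h.ne']⟩,
        fun p hp => by simp only [hq.2.1 p hp, zero_div]⟩
      have hπ : ∀ p, z.1 * π.prob p = (q p).1 := fun p => mul_div_cancel₀ _ h.ne'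
      refine ⟨PursuerStrategy.cons π σ, fun σe e => ?_⟩
      by_cases he : Caught s e
      · rw [utilityFrom_of_caught γ _ σe he, mul_one]
        exact (hz1 e).2
      · rw [utilityFrom_succ γ _ σe he]
        simp only [PursuerStrategy.head_cons, PursuerStrategy.tail_cons]
        calc z.2 e ≤ ∑ e', (σe.head e).prob e' * (γ * ∑ p, (q p).2 e') :=
              (σe.head e).le_sum_mul (hzq e he)
          _ ≤ ∑ e', (σe.head e).prob e' *
                (γ * ∑ p, (q p).1 * utilityFrom γ (σ p) (σe.tail e p) e') := by
              refine Finset.sum_le_sum fun e' _ => mul_le_mul_of_nonneg_left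
                (mul_le_mul_of_nonneg_left (Finset.sum_le_sum fun p _ => ?_) hγ)
                ((σe.head e).prob_nonneg e')
              exact hσ p (σe.tail e p) e'
          _ = _ := by
              simp only [← hπ, Finset.mul_sum]
              rw [Finset.sum_comm]
              refine Finset.sum_congr rfl fun p _ => Finset.sum_congr rfl fun e' _ => ?_
              ring

theorem exists_optimal_pursuerStrategy (hG : ∀ v, ∃ w, G.Adj v w) (hγ : 0 ≤ γ) (t : ℕ)
    (s : Pos V N) (b : Belief V) : ∃ σp : PursuerStrategy G t s, ∀ σe : EvaderStrategy G N t,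
      maxmin G γ t s b.1 ≤ expectedUtility γ b σp σe := by
  obtain ⟨x, hx, h, -⟩ := exists_maxmin (γ := γ) hG t s b.1
  obtain ⟨σp, hσ⟩ := exists_pursuerStrategy hG hγ hx
  refine ⟨σp, fun σe => ?_⟩
  rw [h, expectedUtility_eq_sum]
  refine Finset.sum_le_sum fun e _ => mul_le_mul_of_nonneg_left ?_ (b.2.1 e)
  simpa using hσ σe e

open Classical in
/-- The plan to make the move `p` and to realize the vector `x` after it. -/
def singlePlan {V : Type*} {N : ℕ} (p : Pos V N) (x : V → ℝ) : Pos V N → ℝ × (V → ℝ) :=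
  Pi.single p (1, x)

theorem singlePlan_mem_plans (hG : ∀ v, ∃ w, G.Adj v w) {p : Pos V N} (hp : p ∈ adjPos G s)
    {x : V → ℝ} (hx : x ∈ guaranteed G γ t p) : singlePlan p x ∈ plans G γ t s 1 := by
  classical
  refine ⟨fun p' => ?_, fun p' hp' => ?_, ?_⟩
  · by_cases h : p' = p
    · subst h
      simpa [singlePlan, guaranteed] using hx
    · rw [singlePlan, Pi.single_eq_of_ne h]
      exact const_mem_guarantees hG t p' le_rfl
  · have : p' ≠ p := fun h => hp' (h ▸ hp)
    simp [singlePlan, this]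
  · rw [Finset.sum_eq_single p]
    · simp [singlePlan]
    · intro p' _ h
      simp [singlePlan, h]
    · simp

/-- The plan that surely moves to `p` and then plays best against `spread β π` is one of the plans
bounded by `c`. -/
theorem maxmin_spread_le (hG : ∀ v, ∃ w, G.Adj v w) {β : V → ℝ} {π : V → V → ℝ} {c : ℝ}
    (hc : ∀ q ∈ plans G γ t s 1, planPayoff β π q ≤ c) {p : Pos V N} (hp : p ∈ adjPos G s) :
    maxmin G γ t p (spread β π) ≤ c := by
  classical
  obtain ⟨x, hx, h, -⟩ := exists_maxmin (γ := γ) hG t p (spread β π)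
  refine h.trans_le ((hc _ (singlePlan_mem_plans hG hp hx)).trans' (le_of_eq ?_))
  rw [planPayoff, Finset.sum_eq_single p]
  · simp [singlePlan]
  · intro p' _ h
    simp [singlePlan, h]
  · simp

theorem planPayoff_le_sum_maxmin (hG : ∀ v, ∃ w, G.Adj v w) (β : V → ℝ) (π : V → V → ℝ) {r : ℝ}
    {q : Pos V N → ℝ × (V → ℝ)} (hq : q ∈ plans G γ t s r) :
    planPayoff β π q ≤ ∑ p, (q p).1 * maxmin G γ t p (spread β π) :=
  Finset.sum_le_sum fun p _ => le_maxmin hG _ (hq.1 p)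

/-- As the continuation ignores the start vertex, the rest is a game with the transformed belief,
the same for every `p` because the evader moves without seeing it. -/
theorem expectedUtility_succ (γ : ℝ) (b : Belief V) (σp : PursuerStrategy G (t + 1) s)
    (π : EvaderOneStep G) (σe : Pos V N → EvaderStrategy G N t) :
    expectedUtility γ b σp (EvaderStrategy.cons π σe) = caughtMass s b +
      γ * ∑ p, σp.head.prob p * (freeMass s b *
        expectedUtility γ (transformedBelief s b π) (σp.tail p) (σe p)) := by
  rw [expectedUtility_eq_sum, ← caughtMass_add_sum_freeWeight b (s := s)
    fun e he => utilityFrom_of_caught γ σp _ he]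
  congr 1
  have h1 : ∀ p, freeMass s b *
      expectedUtility γ (transformedBelief s b π) (σp.tail p) (σe p) =
      ∑ e', spread (freeWeight s b) (fun e => (π e).prob) e' *
        utilityFrom γ (σp.tail p) (σe p) e' := by
    intro p
    rw [expectedUtility_eq_sum, ← freeMass_smul_transformedBelief, Finset.mul_sum]
    exact Finset.sum_congr rfl fun e' _ => (mul_assoc _ _ _).symm
  have h2 : ∀ e, freeWeight s b e * utilityFrom γ σp (EvaderStrategy.cons π σe) e =
      freeWeight s b e * (γ * ∑ p, σp.head.prob p * ∑ e', (π e).prob e' *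
        utilityFrom γ (σp.tail p) (σe p) e') := by
    intro e
    by_cases he : Caught s e
    · simp [freeWeight_of_caught b he]
    · rw [utilityFrom_succ γ σp _ he]
      rfl
  simp only [h1, h2, spread, Finset.mul_sum, Finset.sum_mul]
  rw [Finset.sum_comm]
  refine Finset.sum_congr rfl fun p _ => ?_
  rw [Finset.sum_comm]
  refine Finset.sum_congr rfl fun e' _ => Finset.sum_congr rfl fun e _ => ?_
  ring

/-- Play the saddle `π`, then inductively an optimal strategy for the transformed belief. Each first
move of the pursuer then earns at most the saddle value, hence so does every mixture. -/
theorem exists_optimal_evaderStrategy (hG : ∀ v, ∃ w, G.Adj v w) (hγ : 0 ≤ γ) (hγ1 : γ ≤ 1)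
    (t : ℕ) (s : Pos V N) (b : Belief V) :
    ∃ σe : EvaderStrategy G N t, ∀ σp : PursuerStrategy G t s,
      expectedUtility γ b σp σe ≤ maxmin G γ t s b.1 := by
  induction t generalizing s b with
  | zero =>
    refine ⟨fun k => k.elim0, fun σp => ?_⟩
    rw [maxmin_zero hG, expectedUtility_eq_sum, ← caughtMass_add_sum_freeWeight b (s := s)
      fun e he => utilityFrom_of_caught γ σp _ he, Finset.sum_eq_zero, add_zero]
    intro e _
    by_cases he : Caught s e
    · simp [freeWeight_of_caught b he]
    · rw [utilityFrom_zero γ σp _ he, mul_zero]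
  | succ t ih =>
    obtain ⟨π, hπ, q, hq, hsaddle⟩ := exists_saddle hG γ t s (freeWeight s b)
    choose σe hσe using fun p => ih p (transformedBelief s b (evaderOneStepOf hπ))
    refine ⟨EvaderStrategy.cons (evaderOneStepOf hπ) σe, fun σp => ?_⟩
    rw [expectedUtility_succ]
    refine le_trans (add_le_add le_rfl (mul_le_mul_of_nonneg_left ?_ hγ))
      (le_maxmin_succ hG hγ hγ1 b hq fun π' hπ' => hsaddle π' hπ' q hq)
    refine σp.head.sum_mul_le fun p hp => ?_
    calc _ ≤ freeMass s b * maxmin G γ t p (transformedBelief s b (evaderOneStepOf hπ)).1 :=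
          mul_le_mul_of_nonneg_left (hσe p _) (freeMass_nonneg s b)
      _ = maxmin G γ t p (spread (freeWeight s b) π) := by
          rw [← maxmin_smul hG _ (freeMass_nonneg s b), freeMass_smul_transformedBelief]
          rfl
      _ ≤ _ := maxmin_spread_le hG (fun q' hq' => hsaddle π hπ q' hq') hp

theorem isGameValue_iff (hG : ∀ v, ∃ w, G.Adj v w) (hγ : 0 ≤ γ) (hγ1 : γ ≤ 1) (t : ℕ)
    (s : Pos V N) (b : Belief V) (x : ℝ) :
    IsGameValue G γ t s b x ↔ x = maxmin G γ t s b.1 := by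
  obtain ⟨σp, hp⟩ := exists_optimal_pursuerStrategy hG hγ t s b
  obtain ⟨σe, he⟩ := exists_optimal_evaderStrategy hG hγ hγ1 t s b
  constructor
  · rintro ⟨σp', σe', ⟨h1, h2⟩, rfl⟩
    -- Deviating from an equilibrium to the optimal strategies `σe` and `σp` bounds its payoff from
    -- both sides.
    exact le_antisymm ((h2 σe).trans (he σp')) ((hp σe').trans (h1 σp))
  · rintro rfl
    have h : expectedUtility γ b σp σe = maxmin G γ t s b.1 := le_antisymm (he σp) (hp σe)
    exact ⟨σp, σe, ⟨fun σp' => h ▸ he σp', fun σe' => h ▸ hp σe'⟩, h⟩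

theorem valueFunction_eq (hG : ∀ v, ∃ w, G.Adj v w) (hγ : 0 ≤ γ) (hγ1 : γ ≤ 1) (t : ℕ)
    (s : Pos V N) (b : Belief V) : valueFunction G γ t s b = maxmin G γ t s b.1 :=
  (isGameValue_iff hG hγ hγ1 t s b _).1
    (Classical.epsilon_spec ⟨_, (isGameValue_iff hG hγ hγ1 t s b _).2 rfl⟩)

/-! ### The value update formula -/

theorem isMaxMin_of_const {A C : Type*} [Nonempty C] {f : A → C → ℝ} {g : A → ℝ}
    (hf : ∀ a c, f a c = g a) {x : ℝ} (hx : IsGreatest (Set.range g) x) : IsMaxMin f x := by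
  refine ⟨g, fun a => ?_, hx⟩
  rw [show f a = fun _ => g a from funext (hf a), Set.range_const]
  exact isLeast_singleton

theorem exists_isGreatest_range_sum (hG : ∀ v, ∃ w, G.Adj v w) (s : Pos V N)
    (g : Pos V N → ℝ) :
    ∃ x, IsGreatest (Set.range fun π : PursuerOneStep G s => ∑ p, π.prob p * g p) x := by
  obtain ⟨p, hp, hmax⟩ := Set.exists_max_image (adjPos G s) g (Set.toFinite _)
    (adjPos_nonempty hG s)
  refine ⟨g p, ⟨DistOn.dirac p hp, DistOn.sum_dirac_mul p hp g⟩, ?_⟩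
  rintro _ ⟨π, rfl⟩
  exact π.sum_mul_le hmax

theorem isLeast_range_div {A : Type*} {f : A → ℝ} {m c : ℝ} (hc : 0 < c)
    (h : IsLeast (Set.range fun a => c * f a) m) : IsLeast (Set.range f) (m / c) := by
  obtain ⟨⟨a, rfl⟩, hmin⟩ := h
  refine ⟨⟨a, (mul_div_cancel_left₀ _ hc.ne').symm⟩, ?_⟩
  rintro _ ⟨a', rfl⟩
  rw [div_le_iff₀' hc]
  exact hmin ⟨a', rfl⟩

theorem exists_isMaxMin_continuation (hG : ∀ v, ∃ w, G.Adj v w) (hγ : 0 ≤ γ) (hγ1 : γ ≤ 1)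
    (t : ℕ) (s : Pos V N) (b : Belief V) :
    ∃ M, IsMaxMin (continuation (G := G) (fun s b => maxmin G γ t s b.1) s b) M ∧
      maxmin G γ (t + 1) s b.1 = caughtMass s b + γ * freeMass s b * M := by
  obtain ⟨π, hπ, q, hq, hsaddle⟩ := exists_saddle hG γ t s (freeWeight s b)
  have hle := maxmin_succ_le hG hγ b hπ fun q' hq' => hsaddle π hπ q' hq'
  have hge := le_maxmin_succ hG hγ hγ1 b hq fun π' hπ' => hsaddle π' hπ' q hq
  have heq := le_antisymm hle hge
  have := nonempty_evaderOneStep hG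
  -- Without free mass the belief is always `b`, and `M` has only to exist, since its coefficient is
  -- zero.
  rcases (freeMass_nonneg s b).eq_or_lt with h0 | h0
  · obtain ⟨M, hM⟩ := exists_isGreatest_range_sum hG s fun p => maxmin G γ t p b.1
    refine ⟨M, isMaxMin_of_const (fun πp πe => ?_) hM, ?_⟩
    · simp only [continuation, transformedBelief, dif_pos h0.symm]
    · rw [heq, ← h0]
      have hβ : freeWeight s b = 0 := by
        funext e
        by_cases he : Caught s e
        · exact freeWeight_of_caught b he
        · rw [freeWeight_of_not_caught b he]
          classical
          exact (Finset.sum_eq_zero_iff_of_nonneg fun e _ => b.2.1 e).1 h0.symm e (by simp [he])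
      simp [planPayoff_eq, hβ]
  · set F : PursuerOneStep G s → (V → V → ℝ) → ℝ := fun πp π =>
      ∑ p, πp.prob p * maxmin G γ t p (spread (freeWeight s b) π) with hF
    have hFc : ∀ (πp : PursuerOneStep G s) (πe : EvaderOneStep G),
        freeMass s b * continuation (fun s b => maxmin G γ t s b.1) s b πp πe =
          F πp fun e => (πe e).prob := by
      intro πp πe
      simp only [continuation, hF]
      rw [Finset.mul_sum]
      refine Finset.sum_congr rfl fun p _ => ?_
      rw [← freeMass_smul_transformedBelief, maxmin_smul hG _ h0.le]
      ring
    have hmin : ∀ πp : PursuerOneStep G s, ∃ π ∈ evaderSet G, ∀ π' ∈ evaderSet G,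
        F πp π ≤ F πp π' := fun πp => by
      obtain ⟨π, hπ, h⟩ := isCompact_evaderSet.exists_isMinOn (evaderSet_nonempty hG)
        (f := F πp) (Continuous.continuousOn (continuous_finsetSum _ fun p _ =>
          continuous_const.mul ((continuous_maxmin t p).comp (continuous_spread _))))
      exact ⟨π, hπ, fun π' hπ' => h hπ'⟩
    choose μ hμ hμmin using hmin
    refine ⟨planPayoff (freeWeight s b) π q / freeMass s b,
      ⟨fun πp => F πp (μ πp) / freeMass s b, fun πp => isLeast_range_div h0 ⟨?_, ?_⟩, ?_, ?_⟩, ?_⟩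
    · exact ⟨evaderOneStepOf (hμ πp), hFc _ _⟩
    · rintro _ ⟨πe, rfl⟩
      exact (hμmin πp _ (coe_mem_evaderSet πe)).trans_eq (hFc _ _).symm
    · let πp : PursuerOneStep G s := ⟨fun p => (q p).1,
        ⟨fun p => (guarantees_bounds (hq.1 p)).1, hq.2.2⟩, hq.2.1⟩
      refine ⟨πp, congrArg (· / freeMass s b) (le_antisymm ?_ ?_)⟩
      · refine (hμmin πp π hπ).trans ?_
        exact πp.sum_mul_le fun p hp =>
          maxmin_spread_le hG (fun q' hq' => hsaddle π hπ q' hq') hp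
      · exact (hsaddle _ (hμ πp) q hq).trans (planPayoff_le_sum_maxmin hG _ _ hq)
    · rintro _ ⟨πp, rfl⟩
      refine div_le_div_of_nonneg_right ((hμmin πp π hπ).trans ?_) h0.le
      exact πp.sum_mul_le fun p hp =>
        maxmin_spread_le hG (fun q' hq' => hsaddle π hπ q' hq') hp
    · rw [heq, mul_assoc, mul_div_cancel₀ _ h0.ne']

theorem IsMaxMin.iSup_iInf_eq {A C : Type*} {f : A → C → ℝ} {x : ℝ} (h : IsMaxMin f x) :
    ⨆ a, ⨅ c, f a c = x := by
  obtain ⟨m, hm, hx⟩ := h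
  have : (fun a => ⨅ c, f a c) = m := funext fun a => (hm a).csInf_eq
  rw [this]
  exact hx.csSup_eq

/-- For arbitrary `v` nothing need be attained; the bounds on `continuation` pass to infimum and
supremum, and `caughtMass + freeMass = 1` with `γ ≤ 1` does the rest. -/
theorem bellman_mem_Icc (hG : ∀ v, ∃ w, G.Adj v w) (hγ : 0 ≤ γ) (hγ1 : γ ≤ 1)
    {v : Pos V N → Belief V → ℝ} (hv : ∀ s b, v s b ∈ Set.Icc (0 : ℝ) 1) (s : Pos V N)
    (b : Belief V) : bellman G γ v s b ∈ Set.Icc (0 : ℝ) 1 := by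
  have := nonempty_evaderOneStep hG
  have := nonempty_pursuerOneStep hG s
  have hc : ∀ (πp : PursuerOneStep G s) (πe : EvaderOneStep G),
      continuation v s b πp πe ∈ Set.Icc (0 : ℝ) 1 := fun πp πe =>
    ⟨πp.le_sum_mul fun p _ => (hv p _).1, πp.sum_mul_le fun p _ => (hv p _).2⟩
  have hi : ∀ πp : PursuerOneStep G s,
      ⨅ πe : EvaderOneStep G, continuation v s b πp πe ∈ Set.Icc (0 : ℝ) 1 := fun πp =>
    ⟨le_ciInf fun πe => (hc πp πe).1,
      (ciInf_le ⟨0, by rintro _ ⟨πe, rfl⟩; exact (hc πp πe).1⟩ (Classical.arbitrary _)).trans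
        (hc πp _).2⟩
  have hs : ⨆ πp : PursuerOneStep G s, ⨅ πe : EvaderOneStep G, continuation v s b πp πe ∈
      Set.Icc (0 : ℝ) 1 :=
    ⟨Real.iSup_nonneg fun πp => (hi πp).1, ciSup_le fun πp => (hi πp).2⟩
  have h1 := caughtMass_add_freeMass s b
  have h2 := caughtMass_nonneg s b
  have h3 := freeMass_nonneg s b
  refine ⟨add_nonneg h2 (mul_nonneg (mul_nonneg hγ h3) hs.1), ?_⟩
  rw [← h1]
  refine add_le_add le_rfl ?_
  exact (mul_le_of_le_one_right (mul_nonneg hγ h3) hs.2).trans (mul_le_of_le_one_left h3 hγ1)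

end PursuitEvasion

end

theorem theorem3 {V : Type*} [Fintype V] (G : Digraph V) (hG : ∀ v, ∃ w, G.Adj v w) (N : ℕ)
    (γ : ℝ) (hγ0 : 0 ≤ γ) (hγ1 : γ < 1) :
    -- the value of every finite-horizon game is well defined and lies in `[0, 1]`
    (∀ (t : ℕ) (s : PursuitEvasion.Pos V N) (b : PursuitEvasion.Belief V),
      (∃! x, PursuitEvasion.IsGameValue G γ t s b x) ∧
        PursuitEvasion.IsGameValue G γ t s b (PursuitEvasion.valueFunction G γ t s b) ∧
        PursuitEvasion.valueFunction G γ t s b ∈ Set.Icc (0 : ℝ) 1) ∧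
    -- the value update formula, with an attained maximum of attained minima
    (∀ (t : ℕ) (s : PursuitEvasion.Pos V N) (b : PursuitEvasion.Belief V),
      ∃ M : ℝ,
        PursuitEvasion.IsMaxMin
          (fun (πp : PursuitEvasion.PursuerOneStep G s) (πe : PursuitEvasion.EvaderOneStep G) =>
            ∑ p : PursuitEvasion.Pos V N, πp.prob p *
              PursuitEvasion.valueFunction G γ t p (PursuitEvasion.transformedBelief s b πe)) M ∧
        PursuitEvasion.valueFunction G γ (t + 1) s b =
          PursuitEvasion.caughtMass s b + γ * PursuitEvasion.freeMass s b * M) ∧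
    -- the operator `H` maps value functions to value functions, and `v^t = H v^(t-1)`
    (∀ v : PursuitEvasion.Pos V N → PursuitEvasion.Belief V → ℝ,
      (∀ s b, v s b ∈ Set.Icc (0 : ℝ) 1) →
        ∀ s b, PursuitEvasion.bellman G γ v s b ∈ Set.Icc (0 : ℝ) 1) ∧
    (∀ t : ℕ, (PursuitEvasion.valueFunction G γ (t + 1) :
        PursuitEvasion.Pos V N → PursuitEvasion.Belief V → ℝ) =
      PursuitEvasion.bellman G γ (PursuitEvasion.valueFunction G γ t)) := by
  have hval := fun t s b => PursuitEvasion.valueFunction_eq (N := N) hG hγ0 hγ1.le t s b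
  have hval' : ∀ t, (PursuitEvasion.valueFunction G γ t :
      PursuitEvasion.Pos V N → PursuitEvasion.Belief V → ℝ) =
      fun s b => PursuitEvasion.maxmin G γ t s b.1 := fun t =>
    funext fun s => funext fun b => hval t s b
  have hformula := fun t s b =>
    PursuitEvasion.exists_isMaxMin_continuation (N := N) hG hγ0 hγ1.le t s b
  refine ⟨fun t s b => ⟨⟨_, (PursuitEvasion.isGameValue_iff hG hγ0 hγ1.le t s b _).2 rfl,
      fun x hx => (PursuitEvasion.isGameValue_iff hG hγ0 hγ1.le t s b x).1 hx⟩,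
      (PursuitEvasion.isGameValue_iff hG hγ0 hγ1.le t s b _).2 (hval t s b), ?_⟩, fun t s b => ?_,
    fun v hv s b => PursuitEvasion.bellman_mem_Icc hG hγ0 hγ1.le hv s b, fun t => ?_⟩
  · rw [hval]
    exact PursuitEvasion.maxmin_mem_Icc hG t s b
  · rw [hval' t, hval]
    exact hformula t s b
  · funext s b
    obtain ⟨M, hM, h⟩ := hformula t s b
    rw [hval, hval' t, h, PursuitEvasion.bellman, hM.iSup_iInf_eq]
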